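/- **Definitions.** A frame is a complete lattice satisfying $a\wedge\bigvee S=\bigvee\{a\wedge s\mid s\in S\}$; it is *algebraic* if every element is a join of compact elements, and *compact* if its top element is compact. Let $\mathsf{KAlgFrm}$ be the category of compact algebraic frames, with morphisms the maps that preserve arbitrary joins, finite meets, and compact elements. Meet-semilattices have a top element, and homomorphisms of meet-semilattices preserve all finite meets, including the top. A meet-semilattice $M$ is *distributive* if $a\wedge b\le c$ implies that $c=a'\wedge b'$ for some $a'\ge a$, $b'\ge b$; it is *bounded* if it also has a bottom element. Let $\mathsf{BDMS_P}$ be the category of bounded distributive meet-semilattices whose morphisms are the meet-semilattice homomorphisms $\alpha:M_1\to M_2$ such that, for every finite $S\subseteq M_1$ and every upper bound $x$ of $\alpha[S]$, there is an upper bound $c$ of $S$ with $\alpha(c)\le x$. A *prime filter* of $M$ is a proper filter $P$ such that, for all filters $F_1,F_2$ of $M$, $F_1\cap F_2\subseteq P$ implies $F_1\subseteq P$ or $F_2\subseteq P$. Distributive join-semilattices and prime ideals are the order-dual notions. A *Priestley space* is a compact ordered space in which, whenever $x\not\le y$, some clopen upset contains $x$ and misses $y$. Given a subset $X_0$ of a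 Priestley space $X$, a clopen upset $U$ is *admissible* if every maximal element of $X\setminus U$ lies in $X_0$; $\mathcal A(X)$ denotes the set of admissible clopen upsets, and $\mathcal I_x=\{U\in\mathcal A(X)\mid x\notin U\}$. A *generalized Priestley space* is a Priestley space $X$ with a dense subset $X_0$ such that: each $x\in X$ lies below some $y\in X_0$; $x\in X_0$ iff $\mathcal I_x$ is directed under inclusion; and $x\le y$ iff every $U\in\mathcal A(X)$ containing $x$ contains $y$. Let $\mathsf{GPS_P}$ be the category of generalized Priestley spaces whose morphisms $f:X\to Y$ are the order-preserving maps with $f^{-1}(U)\in\mathcal A(X)$ for all $U\in\mathcal A(Y)$ and with $f[X_0]\subseteq Y_0$. **Theorem.** 1. $\mathsf{KAlgFrm}$ is equivalent to $\mathsf{BDMS_P}$. 2. $\mathsf{KAlgFrm}$ is dually equivalent to $\mathsf{GPS_P}$. 3. A meet-semilattice homomorphism $\alpha:M_1\to M_2$ between bounded distributive meet-semilattices is a $\mathsf{BDMS_P}$-morphism if and only if $\alpha^{-1}(P)$ is a prime filter of $M_1$ for every prime filter $P$ of $M_2$. 4. Consequently (Hansoul–Poussart duality), the category of bounded distributive join-semilattices,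 with morphisms the maps that preserve finite joins (including the bottom) and pull prime ideals back to prime ideals, is dually equivalent to $\mathsf{GPS_P}$. -/

import Mathlib

open CategoryTheory

universe u

/-! ### Compact algebraic frames -/

/-- A compact algebraic frame: a frame in which every element is a join of compact elements and
whose top element is compact. -/
structure KAlgFrm : Type (u + 1) where
  carrier : Type u
  [frame : Order.Frame carrier]
  [algebraic : IsCompactlyGenerated carrier]
  isCompactElement_top : IsCompactElement (⊤ : carrier)

namespace KAlgFrm

instance : CoeSort KAlgFrm.{u} (Type u) := ⟨KAlgFrm.carrier⟩

attribute [instance] KAlgFrm.frame KAlgFrm.algebraic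

/-- Morphisms: maps preserving arbitrary joins, finite meets, and compact elements. -/
@[ext]
structure Hom (L M : KAlgFrm.{u}) : Type u where
  toFrameHom : FrameHom L M
  map_isCompactElement : ∀ k : L, IsCompactElement k → IsCompactElement (toFrameHom k)

instance : Category KAlgFrm.{u} where
  Hom := Hom
  id L := ⟨FrameHom.id L, fun _ hk => hk⟩
  comp f g := ⟨g.toFrameHom.comp f.toFrameHom,
    fun k hk => g.map_isCompactElement _ (f.map_isCompactElement k hk)⟩

end KAlgFrm

/-! ### Bounded distributive meet-semilattices -/

/-- Distributivity of a meet-semilattice. -/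
def IsDistribMeetSemilattice (M : Type u) [SemilatticeInf M] : Prop :=
  ∀ a b c : M, a ⊓ b ≤ c → ∃ a' b' : M, a ≤ a' ∧ b ≤ b' ∧ a' ⊓ b' = c

/-- A prime filter of a meet-semilattice: a proper filter `P` such that `F ∩ G ⊆ P` implies
`F ⊆ P` or `G ⊆ P` for all filters `F`, `G`. -/
structure IsPrimeFilter {M : Type u} [SemilatticeInf M] (P : Set M) : Prop where
  isPFilter : Order.IsPFilter P
  ne_univ : P ≠ Set.univ
  subset_or_subset : ∀ F G : Set M, Order.IsPFilter F → Order.IsPFilter G →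
    F ∩ G ⊆ P → F ⊆ P ∨ G ⊆ P

/-- The condition defining `P`-morphisms: whenever `S` is finite and `x` is an upper bound of the
image of `S`, there is an upper bound `c` of `S` with `α c ≤ x`. -/
def LiftsUpperBounds {M N : Type u} [Preorder M] [Preorder N] (α : M → N) : Prop :=
  ∀ S : Set M, S.Finite → ∀ x ∈ upperBounds (α '' S), ∃ c ∈ upperBounds S, α c ≤ x

/-- A bounded distributive meet-semilattice. -/
structure BDMSP : Type (u + 1) where
  carrier : Type u
  [semilatticeInf : SemilatticeInf carrier]
  [boundedOrder : BoundedOrder carrier]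
  distrib : IsDistribMeetSemilattice carrier

namespace BDMSP

instance : CoeSort BDMSP.{u} (Type u) := ⟨BDMSP.carrier⟩

attribute [instance] BDMSP.semilatticeInf BDMSP.boundedOrder

/-- Morphisms: maps preserving finite meets (including the top element) and satisfying
`LiftsUpperBounds`. -/
@[ext]
structure Hom (M N : BDMSP.{u}) : Type u where
  toInfTopHom : InfTopHom M N
  liftsUpperBounds : LiftsUpperBounds toInfTopHom

instance : Category BDMSP.{u} where
  Hom := Hom
  id M := ⟨InfTopHom.id M, fun S _ x hx => ⟨x, fun s hs => hx ⟨s, hs, rfl⟩, le_rfl⟩⟩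
  comp {M N K} f g := ⟨g.toInfTopHom.comp f.toInfTopHom, fun S hS x hx => by
    obtain ⟨d, hd, hdx⟩ := g.liftsUpperBounds (f.toInfTopHom '' S) (hS.image _) x (by
      rintro _ ⟨_, ⟨s, hs, rfl⟩, rfl⟩
      exact hx ⟨s, hs, rfl⟩)
    obtain ⟨c, hc, hcd⟩ := f.liftsUpperBounds S hS d hd
    exact ⟨c, hc, (OrderHomClass.mono g.toInfTopHom hcd).trans hdx⟩⟩

end BDMSP

/-! ### Bounded distributive join-semilattices -/

/-- Distributivity of a join-semilattice. -/
def IsDistribJoinSemilattice (J : Type u) [SemilatticeSup J] : Prop :=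
  ∀ a b c : J, c ≤ a ⊔ b → ∃ a' b' : J, a' ≤ a ∧ b' ≤ b ∧ a' ⊔ b' = c

/-- A prime ideal of a join-semilattice: a proper ideal `P` such that `I ∩ J ⊆ P` implies
`I ⊆ P` or `J ⊆ P` for all ideals `I`, `J`. -/
structure IsPrimeIdealOfSup {J : Type u} [SemilatticeSup J] (P : Set J) : Prop where
  isIdeal : Order.IsIdeal P
  ne_univ : P ≠ Set.univ
  subset_or_subset : ∀ F G : Set J, Order.IsIdeal F → Order.IsIdeal G →
    F ∩ G ⊆ P → F ⊆ P ∨ G ⊆ P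

/-- A bounded distributive join-semilattice. -/
structure BDJS : Type (u + 1) where
  carrier : Type u
  [semilatticeSup : SemilatticeSup carrier]
  [boundedOrder : BoundedOrder carrier]
  distrib : IsDistribJoinSemilattice carrier

namespace BDJS

instance : CoeSort BDJS.{u} (Type u) := ⟨BDJS.carrier⟩

attribute [instance] BDJS.semilatticeSup BDJS.boundedOrder

/-- Morphisms: maps preserving finite joins (including the bottom element) under which the inverse
image of every prime ideal is a prime ideal. -/
@[ext]
structure Hom (J K : BDJS.{u}) : Type u where
  toSupBotHom : SupBotHom J K
  isPrimeIdeal_preimage : ∀ P : Set K, IsPrimeIdealOfSup P → IsPrimeIdealOfSup (toSupBotHom ⁻¹' P)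

instance : Category BDJS.{u} where
  Hom := Hom
  id J := ⟨SupBotHom.id J, fun _ hP => hP⟩
  comp f g := ⟨g.toSupBotHom.comp f.toSupBotHom,
    fun P hP => f.isPrimeIdeal_preimage _ (g.isPrimeIdeal_preimage P hP)⟩

end BDJS

/-! ### Generalized Priestley spaces -/

/-- Relative to a subset `X₀` of an ordered topological space, a clopen upset `U` is admissible
if all maximal elements of its complement lie in `X₀`. -/
structure IsAdmissible {X : Type u} [TopologicalSpace X] [PartialOrder X] (X₀ U : Set X) :
    Prop where
  isClopen : IsClopen U
  isUpperSet : IsUpperSet U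
  maximal_mem : ∀ x, Maximal (· ∈ Uᶜ) x → x ∈ X₀

/-- A generalized Priestley space. (In Mathlib, `PriestleySpace` is only the separation axiom.) -/
structure GPSP : Type (u + 1) where
  carrier : Type u
  [topologicalSpace : TopologicalSpace carrier]
  [partialOrder : PartialOrder carrier]
  [compactSpace : CompactSpace carrier]
  [priestleySpace : PriestleySpace carrier]
  /-- The distinguished subset `X₀`. -/
  core : Set carrier
  dense_core : Dense core
  exists_le_core : ∀ x, ∃ y ∈ core, x ≤ y
  mem_core_iff : ∀ x, x ∈ core ↔ DirectedOn (· ⊆ ·) {U | IsAdmissible core U ∧ x ∉ U}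
  le_iff : ∀ x y, x ≤ y ↔ ∀ U, IsAdmissible core U → x ∈ U → y ∈ U

namespace GPSP

instance : CoeSort GPSP.{u} (Type u) := ⟨GPSP.carrier⟩

attribute [instance] GPSP.topologicalSpace GPSP.partialOrder GPSP.compactSpace GPSP.priestleySpace

/-- Morphisms: strong Priestley morphisms (order-preserving maps under which the inverse image of
every admissible clopen upset is an admissible clopen upset) that map `X₀` into `Y₀`. -/
@[ext]
structure Hom (X Y : GPSP.{u}) : Type u where
  toOrderHom : X →o Y
  isAdmissible_preimage : ∀ U : Set Y, IsAdmissible Y.core U →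
    IsAdmissible X.core (toOrderHom ⁻¹' U)
  map_core : ∀ x ∈ X.core, toOrderHom x ∈ Y.core

instance : Category GPSP.{u} where
  Hom := Hom
  id X := ⟨OrderHom.id, fun _ hU => hU, fun _ hx => hx⟩
  comp f g := ⟨g.toOrderHom.comp f.toOrderHom,
    fun U hU => f.isAdmissible_preimage _ (g.isAdmissible_preimage U hU),
    fun x hx => g.map_core _ (f.map_core x hx)⟩

end GPSP

/-!
A compact algebraic frame is the lattice of ideals of its compact elements, which form a bounded
distributive join-semilattice. A map of compact elements that preserves finite joins extends by
joins to a left adjoint, and compactness of the elements involved shows that the extension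
preserves finite meets exactly when lower bounds of images lift to lower bounds; under the reverse
order this is the condition on morphisms of meet-semilattices.

A filter is prime if and only if its complement is nonempty and directed. A filter that is maximal
among those missing a given element is prime by distributivity, and this separates filters from
elements by prime filters. Hence pulling back prime filters to prime filters forces upper bounds to
lift.

The points of the dual space of `M` are the optimal filters. They form the closure of the set of
prime filters in the Cantor space of functions from `M` to `Bool`, so they are compact and the prime
filters are dense. An admissible clopen upset is determined by the prime filters it misses, and
directedness of their complements together with compactness writes it as a finite meet of sets of
the form `{P | a ∈ P}`. Conversely every optimal filter of admissible clopen upsets is the set of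
admissible neighbourhoods of a point, again by compactness.
-/

/-! ### Filters and prime filters -/

section PrimeFilter

theorem exists_mem_upperBounds_of_directedOn {α : Type*} [Preorder α] {D S : Set α}
    (hD : DirectedOn (· ≤ ·) D) (hne : D.Nonempty) (hS : S.Finite) (hSD : S ⊆ D) :
    ∃ c ∈ D, c ∈ upperBounds S := by
  have : Nonempty D := hne.to_subtype
  obtain ⟨c, hc⟩ := hD.directed_val.finite_set_le (hS.preimage Subtype.val_injective.injOn)
  exact ⟨c, c.2, fun s hs => hc ⟨s, hSD hs⟩ hs⟩

theorem isPFilter_setOf_exists_map_le {α β : Type*} [Preorder α] [Preorder β] {F : Set α}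
    (hF : Order.IsPFilter F) {f : α → β} (hf : Monotone f) :
    Order.IsPFilter {y | ∃ p ∈ F, f p ≤ y} := by
  obtain ⟨a, ha⟩ := hF.Nonempty
  refine Order.IsPFilter.of_def ⟨f a, a, ha, le_rfl⟩ ?_ fun hxy ⟨p, hp, hpx⟩ =>
    ⟨p, hp, hpx.trans hxy⟩
  rintro y ⟨p, hp, hpy⟩ z ⟨q, hq, hqz⟩
  obtain ⟨r, hr, hrp, hrq⟩ := hF.Directed p hp q hq
  exact ⟨f r, ⟨r, hr, le_rfl⟩, (hf hrp).trans hpy, (hf hrq).trans hqz⟩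

theorem isUpperSet_of_isPFilter {α : Type*} [Preorder α] {F : Set α} (hF : Order.IsPFilter F) :
    IsUpperSet F := fun _ _ hab ha => hF.IsLowerSet hab ha

theorem isPFilter_Ici {α : Type*} [Preorder α] (a : α) : Order.IsPFilter (Set.Ici a) :=
  (Order.PFilter.principal a).isPFilter

theorem exists_maximal_isPFilter_notMem {α : Type*} [Preorder α] {F : Set α}
    (hF : Order.IsPFilter F) {x : α} (hx : x ∉ F) :
    ∃ P, F ⊆ P ∧ Maximal (fun G : Set α => Order.IsPFilter G ∧ x ∉ G) P := by
  refine zorn_subset_nonempty {G : Set α | Order.IsPFilter G ∧ x ∉ G}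
    (fun c hc hchain hne => ⟨⋃₀ c, ⟨?_, ?_⟩, fun s hs => Set.subset_sUnion_of_mem hs⟩) F ⟨hF, hx⟩
  · exact Order.isIdeal_sUnion_of_isChain (P := αᵒᵈ) (fun G hG => (hc hG).1) hchain hne
  · rintro ⟨G, hG, hxG⟩
    exact (hc hG).2 hxG

variable {M N : Type u} [SemilatticeInf M] [SemilatticeInf N] {F P : Set M}

theorem inf_mem_of_isPFilter (hF : Order.IsPFilter F) {a b : M} (ha : a ∈ F) (hb : b ∈ F) :
    a ⊓ b ∈ F := by
  obtain ⟨c, hc, hca, hcb⟩ := hF.Directed a ha b hb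
  exact isUpperSet_of_isPFilter hF (le_inf hca hcb) hc

theorem isPFilter_iff [OrderTop M] :
    Order.IsPFilter P ↔ IsUpperSet P ∧ ⊤ ∈ P ∧ ∀ a ∈ P, ∀ b ∈ P, a ⊓ b ∈ P := by
  constructor
  · intro h
    obtain ⟨x, hx⟩ := h.Nonempty
    exact ⟨isUpperSet_of_isPFilter h, h.IsLowerSet (le_top (a := OrderDual.ofDual x)) hx,
      fun a ha b hb => inf_mem_of_isPFilter h ha hb⟩
  · rintro ⟨hup, htop, hinf⟩
    exact Order.IsPFilter.of_def ⟨⊤, htop⟩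
      (fun a ha b hb => ⟨a ⊓ b, hinf a ha b hb, inf_le_left, inf_le_right⟩) fun h ha => hup h ha

theorem IsPrimeFilter.directedOn_compl (hP : IsPrimeFilter P) : DirectedOn (· ≤ ·) Pᶜ := by
  intro a ha b hb
  by_contra! hab
  have hsub : Set.Ici a ∩ Set.Ici b ⊆ P := fun c hc => by
    by_contra hcP
    exact hab c hcP hc.1 hc.2
  rcases hP.subset_or_subset _ _ (isPFilter_Ici a) (isPFilter_Ici b) hsub with h | h
  · exact ha (h le_rfl)
  · exact hb (h le_rfl)

theorem isPrimeFilter_iff_directedOn_compl :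
    IsPrimeFilter P ↔ Order.IsPFilter P ∧ Pᶜ.Nonempty ∧ DirectedOn (· ≤ ·) Pᶜ := by
  refine ⟨fun h => ⟨h.isPFilter, Set.nonempty_compl.2 h.ne_univ, h.directedOn_compl⟩, ?_⟩
  rintro ⟨hP, hne, hdir⟩
  refine ⟨hP, Set.nonempty_compl.1 hne, fun F G hF hG hFG => ?_⟩
  by_contra! h
  obtain ⟨a, haF, haP⟩ := Set.not_subset.1 h.1
  obtain ⟨b, hbG, hbP⟩ := Set.not_subset.1 h.2
  obtain ⟨c, hc, hac, hbc⟩ := hdir a haP b hbP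
  exact hc (hFG ⟨isUpperSet_of_isPFilter hF hac haF, isUpperSet_of_isPFilter hG hbc hbG⟩)

theorem isPrimeFilter_iff_forall_finite :
    IsPrimeFilter P ↔ Order.IsPFilter P ∧
      ∀ S : Set M, S.Finite → S ⊆ Pᶜ → ∃ c ∈ upperBounds S, c ∉ P := by
  rw [isPrimeFilter_iff_directedOn_compl]
  refine and_congr_right fun _ => ⟨fun ⟨hne, hdir⟩ S hS hSP => ?_, fun h => ⟨?_, ?_⟩⟩
  · obtain ⟨c, hc, hcS⟩ := exists_mem_upperBounds_of_directedOn hdir hne hS hSP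
    exact ⟨c, hcS, hc⟩
  · obtain ⟨c, -, hc⟩ := h ∅ Set.finite_empty (Set.empty_subset _)
    exact ⟨c, hc⟩
  · intro a ha b hb
    obtain ⟨c, hcS, hc⟩ := h {a, b} (Set.toFinite _) (Set.pair_subset ha hb)
    exact ⟨c, hc, hcS (by simp), hcS (by simp)⟩

theorem exists_inf_le_of_maximal_isPFilter {x a : M}
    (hP : Maximal (fun G : Set M => Order.IsPFilter G ∧ x ∉ G) P) (ha : a ∉ P) :
    ∃ p ∈ P, p ⊓ a ≤ x := by
  by_contra! hx
  have hG : Order.IsPFilter {y | ∃ p ∈ P, p ⊓ a ≤ y} :=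
    isPFilter_setOf_exists_map_le hP.prop.1 fun _ _ h => inf_le_inf_right a h
  have hPG : P ⊆ {y | ∃ p ∈ P, p ⊓ a ≤ y} := fun p hp => ⟨p, hp, inf_le_left⟩
  have haG : a ∈ {y | ∃ p ∈ P, p ⊓ a ≤ y} := by
    obtain ⟨p, hp⟩ := hP.prop.1.Nonempty
    exact ⟨p, hp, inf_le_right⟩
  exact ha (hP.le_of_ge ⟨hG, fun ⟨p, hp, hpx⟩ => hx p hp hpx⟩ hPG haG)

theorem isPrimeFilter_of_maximal (hM : IsDistribMeetSemilattice M) {x : M}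
    (hP : Maximal (fun G : Set M => Order.IsPFilter G ∧ x ∉ G) P) : IsPrimeFilter P := by
  have hup : IsUpperSet P := isUpperSet_of_isPFilter hP.prop.1
  refine isPrimeFilter_iff_directedOn_compl.2 ⟨hP.prop.1, ⟨x, hP.prop.2⟩, fun a ha b hb => ?_⟩
  obtain ⟨p, hp, hpa⟩ := exists_inf_le_of_maximal_isPFilter hP ha
  obtain ⟨q, hq, hqb⟩ := exists_inf_le_of_maximal_isPFilter hP hb
  -- Writing `x = p' ⊓ a'` and then `a' = q' ⊓ b'` produces an upper bound `b'` of `a` and `b`.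
  obtain ⟨p', a', hpp', haa', rfl⟩ := hM p a x hpa
  obtain ⟨q', b', hqq', hbb', rfl⟩ := hM q b a' (hqb.trans inf_le_right)
  have hb' : b' ∉ P := fun h => hP.prop.2 (inf_mem_of_isPFilter hP.prop.1 (hup hpp' hp)
    (inf_mem_of_isPFilter hP.prop.1 (hup hqq' hq) h))
  exact ⟨b', hb', haa'.trans inf_le_right, hbb'⟩

theorem exists_isPrimeFilter_notMem (hM : IsDistribMeetSemilattice M) (hF : Order.IsPFilter F)
    {x : M} (hx : x ∉ F) : ∃ P, IsPrimeFilter P ∧ F ⊆ P ∧ x ∉ P := by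
  obtain ⟨P, hFP, hP⟩ := exists_maximal_isPFilter_notMem hF hx
  exact ⟨P, isPrimeFilter_of_maximal hM hP, hFP, hP.prop.2⟩

theorem exists_isPrimeFilter_of_not_le (hM : IsDistribMeetSemilattice M) {a b : M}
    (hab : ¬a ≤ b) : ∃ P, IsPrimeFilter P ∧ a ∈ P ∧ b ∉ P := by
  obtain ⟨P, hP, hF, hb⟩ := exists_isPrimeFilter_notMem hM (isPFilter_Ici a) hab
  exact ⟨P, hP, hF le_rfl, hb⟩

variable [OrderTop M]

theorem isPFilter_upperBounds (S : Set M) : Order.IsPFilter (upperBounds S) :=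
  isPFilter_iff.2 ⟨fun _ _ hab ha _ hs => (ha hs).trans hab, fun _ _ => le_top,
    fun _ ha _ hb _ hs => le_inf (ha hs) (hb hs)⟩

theorem liftsUpperBounds_of_isPrimeFilter_preimage (hN : IsDistribMeetSemilattice N)
    {α : M → N} (hα : Monotone α) (h : ∀ P, IsPrimeFilter P → IsPrimeFilter (α ⁻¹' P)) :
    LiftsUpperBounds α := by
  intro S hS x hx
  by_contra! hc
  have hF : Order.IsPFilter {y | ∃ c ∈ upperBounds S, α c ≤ y} :=
    isPFilter_setOf_exists_map_le (isPFilter_upperBounds S) hα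
  obtain ⟨P, hP, hFP, hxP⟩ := exists_isPrimeFilter_notMem hN hF fun ⟨c, hcS, hcx⟩ => hc c hcS hcx
  have hSP : S ⊆ (α ⁻¹' P)ᶜ := fun s hs hsP =>
    hxP (isUpperSet_of_isPFilter hP.isPFilter (hx ⟨s, hs, rfl⟩) hsP)
  obtain ⟨c, hcS, hcP⟩ := (isPrimeFilter_iff_forall_finite.1 (h P hP)).2 S hS hSP
  exact hcP (hFP ⟨c, hcS, le_rfl⟩)

variable [OrderTop N]

theorem isPFilter_preimage (α : InfTopHom M N) {P : Set N} (hP : Order.IsPFilter P) :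
    Order.IsPFilter (α ⁻¹' P) := by
  obtain ⟨hup, htop, hinf⟩ := isPFilter_iff.1 hP
  refine isPFilter_iff.2 ⟨hup.preimage (OrderHomClass.mono α), ?_, fun a ha b hb => ?_⟩
  · rwa [Set.mem_preimage, map_top]
  · rw [Set.mem_preimage, map_inf]
    exact hinf _ ha _ hb

theorem IsPrimeFilter.preimage {α : InfTopHom M N} (hα : LiftsUpperBounds α) {P : Set N}
    (hP : IsPrimeFilter P) : IsPrimeFilter (α ⁻¹' P) := by
  refine isPrimeFilter_iff_forall_finite.2
    ⟨isPFilter_preimage α hP.isPFilter, fun S hS hSP => ?_⟩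
  obtain ⟨x, hxS, hx⟩ := (isPrimeFilter_iff_forall_finite.1 hP).2 (α '' S) (hS.image α)
    (Set.image_subset_iff.2 hSP)
  obtain ⟨c, hcS, hcx⟩ := hα S hS x hxS
  exact ⟨c, hcS, fun hc => hx (isUpperSet_of_isPFilter hP.isPFilter hcx hc)⟩

theorem liftsUpperBounds_iff_isPrimeFilter_preimage (hN : IsDistribMeetSemilattice N)
    (α : InfTopHom M N) :
    LiftsUpperBounds α ↔ ∀ P : Set N, IsPrimeFilter P → IsPrimeFilter (α ⁻¹' P) :=
  ⟨fun hα _ hP => hP.preimage hα,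
    liftsUpperBounds_of_isPrimeFilter_preimage hN (OrderHomClass.mono α)⟩

end PrimeFilter

/-! ### Optimal filters -/

section OptimalFilter

variable {M N : Type u} [SemilatticeInf M] [SemilatticeInf N] {P : Set M}

/-- An optimal filter: a filter whose complement is a Frink ideal. It contains a member of the
finite set `S` as soon as it contains an element lying below all upper bounds of `S`; for `S = ∅`
this says that it is proper in a semilattice with bottom element. The prime filters are dense
among the optimal ones, which are the points of the dual space. -/
structure IsOptimalFilter (P : Set M) : Prop where
  isPFilter : Order.IsPFilter P
  exists_mem : ∀ S : Finset M, ∀ a ∈ P, (∀ c ∈ upperBounds (S : Set M), a ≤ c) → ∃ s ∈ S, s ∈ P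

theorem IsOptimalFilter.bot_notMem [OrderBot M] (hP : IsOptimalFilter P) :
    ⊥ ∉ P := fun h => by
  obtain ⟨s, hs, -⟩ := hP.exists_mem ∅ ⊥ h fun _ _ => bot_le
  exact Finset.notMem_empty s hs

theorem IsPrimeFilter.isOptimalFilter (hP : IsPrimeFilter P) : IsOptimalFilter P where
  isPFilter := hP.isPFilter
  exists_mem S a ha haS := by
    by_contra! h
    obtain ⟨c, hcS, hc⟩ := (isPrimeFilter_iff_forall_finite.1 hP).2 S S.finite_toSet h
    exact hc (isUpperSet_of_isPFilter hP.isPFilter (haS c hcS) ha)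

variable [OrderTop M] [OrderTop N]

theorem IsOptimalFilter.preimage {α : InfTopHom M N} (hα : LiftsUpperBounds α) {P : Set N}
    (hP : IsOptimalFilter P) : IsOptimalFilter (α ⁻¹' P) where
  isPFilter := isPFilter_preimage α hP.isPFilter
  exists_mem S a ha haS := by
    classical
    have hle : ∀ x ∈ upperBounds (S.image α : Set N), α a ≤ x := fun x hx => by
      obtain ⟨c, hcS, hcx⟩ := hα S S.finite_toSet x (by rwa [Finset.coe_image] at hx)
      exact (OrderHomClass.mono α (haS c hcS)).trans hcx
    obtain ⟨_, hs, hsP⟩ := hP.exists_mem (S.image α) (α a) ha hle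
    obtain ⟨s, hsS, rfl⟩ := Finset.mem_image.1 hs
    exact ⟨s, hsS, hsP⟩

theorem IsOptimalFilter.exists_not_le (hP : IsOptimalFilter P) (I : Finset M) :
    ∃ a c, ¬a ≤ c ∧ ∀ b ∈ I, (b ∈ P → a ≤ b) ∧ (b ∉ P → b ≤ c) := by
  classical
  obtain ⟨-, htop, hinf⟩ := isPFilter_iff.1 hP.isPFilter
  have ha : {b ∈ I | b ∈ P}.inf id ∈ P :=
    Finset.inf_induction htop hinf fun b hb => (Finset.mem_filter.1 hb).2
  by_contra! h
  obtain ⟨s, hs, hsP⟩ := hP.exists_mem {b ∈ I | b ∉ P} _ ha fun c hc => by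
    by_contra hac
    obtain ⟨b, hb, hbP⟩ := h _ c hac
    obtain ⟨hbP, hbc⟩ := hbP fun hbP => Finset.inf_le (f := id) (Finset.mem_filter.2 ⟨hb, hbP⟩)
    exact hbc (hc (Finset.mem_filter.2 ⟨hb, hbP⟩))
  exact (Finset.mem_filter.1 hs).2 hsP

theorem IsOptimalFilter.exists_isPrimeFilter_mem_iff (hM : IsDistribMeetSemilattice M)
    (hP : IsOptimalFilter P) (I : Finset M) :
    ∃ Q, IsPrimeFilter Q ∧ ∀ b ∈ I, b ∈ Q ↔ b ∈ P := by
  obtain ⟨a, c, hac, hI⟩ := hP.exists_not_le I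
  obtain ⟨Q, hQ, haQ, hcQ⟩ := exists_isPrimeFilter_of_not_le hM hac
  have hup := isUpperSet_of_isPFilter hQ.isPFilter
  refine ⟨Q, hQ, fun b hb => ⟨fun hbQ => ?_, fun hbP => hup ((hI b hb).1 hbP) haQ⟩⟩
  by_contra hbP
  exact hcQ (hup ((hI b hb).2 hbP) hbQ)

theorem isOptimalFilter_of_forall_finset
    (h : ∀ I : Finset M, ∃ Q, IsOptimalFilter Q ∧ ∀ b ∈ I, b ∈ Q ↔ b ∈ P) :
    IsOptimalFilter P := by
  classical
  refine ⟨isPFilter_iff.2 ⟨fun a b hab ha => ?_, ?_, fun a ha b hb => ?_⟩, fun S a ha haS => ?_⟩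
  · obtain ⟨Q, hQ, hI⟩ := h {a, b}
    exact (hI b (by simp)).1 (isUpperSet_of_isPFilter hQ.isPFilter hab ((hI a (by simp)).2 ha))
  · obtain ⟨Q, hQ, hI⟩ := h {⊤}
    exact (hI ⊤ (by simp)).1 (isPFilter_iff.1 hQ.isPFilter).2.1
  · obtain ⟨Q, hQ, hI⟩ := h {a, b, a ⊓ b}
    exact (hI _ (by simp)).1 ((isPFilter_iff.1 hQ.isPFilter).2.2 a ((hI a (by simp)).2 ha) b
      ((hI b (by simp)).2 hb))
  · obtain ⟨Q, hQ, hI⟩ := h (insert a S)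
    obtain ⟨s, hs, hsQ⟩ := hQ.exists_mem S a ((hI a (by simp)).2 ha) haS
    exact ⟨s, hs, (hI s (Finset.mem_insert_of_mem hs)).1 hsQ⟩

end OptimalFilter

/-! ### Isomorphisms and duals of semilattices -/

namespace BDMSP

variable {M N : BDMSP.{u}}

/-- An order isomorphism as a morphism of `BDMSP`. -/
def homOfOrderIso (e : M ≃o N) : M ⟶ N where
  toInfTopHom := ⟨⟨e, map_inf e⟩, map_top e⟩
  liftsUpperBounds _ _ x hx :=
    ⟨e.symm x, fun s hs => e.le_symm_apply.2 (hx ⟨s, hs, rfl⟩), (e.apply_symm_apply x).le⟩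

/-- An order isomorphism as an isomorphism of `BDMSP`. -/
def isoOfOrderIso (e : M ≃o N) : M ≅ N where
  hom := homOfOrderIso e
  inv := homOfOrderIso e.symm
  hom_inv_id := Hom.ext (DFunLike.ext _ _ e.symm_apply_apply)
  inv_hom_id := Hom.ext (DFunLike.ext _ _ e.apply_symm_apply)

theorem Hom.apply_eq_of_eq {f g : M ⟶ N} (h : f = g) (a : M) :
    f.toInfTopHom a = g.toInfTopHom a :=
  h ▸ rfl

end BDMSP

theorem IsDistribJoinSemilattice.dual {J : Type u} [SemilatticeSup J]
    (hJ : IsDistribJoinSemilattice J) : IsDistribMeetSemilattice Jᵒᵈ :=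
  fun a b c h => hJ a b c h

theorem IsDistribMeetSemilattice.dual {M : Type u} [SemilatticeInf M]
    (hM : IsDistribMeetSemilattice M) : IsDistribJoinSemilattice Mᵒᵈ :=
  fun a b c h => hM a b c h

theorem isPrimeFilter_dual_iff {J : Type u} [SemilatticeSup J] {P : Set Jᵒᵈ} :
    IsPrimeFilter P ↔ IsPrimeIdealOfSup (OrderDual.toDual ⁻¹' P) :=
  ⟨fun h => ⟨h.isPFilter, h.ne_univ, h.subset_or_subset⟩,
    fun h => ⟨h.isIdeal, h.ne_univ, h.subset_or_subset⟩⟩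

theorem liftsUpperBounds_dual_iff {J K : Type u} [SemilatticeSup J] [OrderBot J] [SemilatticeSup K]
    [OrderBot K] (hK : IsDistribJoinSemilattice K) (f : SupBotHom J K) :
    LiftsUpperBounds (SupBotHom.dual f) ↔
      ∀ P : Set K, IsPrimeIdealOfSup P → IsPrimeIdealOfSup (f ⁻¹' P) :=
  (liftsUpperBounds_iff_isPrimeFilter_preimage hK.dual _).trans
    ⟨fun h P hP => isPrimeFilter_dual_iff.1 (h (OrderDual.ofDual ⁻¹' P)
      (isPrimeFilter_dual_iff.2 hP)),
    fun h _ hP => isPrimeFilter_dual_iff.2 (h _ (isPrimeFilter_dual_iff.1 hP))⟩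

namespace BDJS

/-- Passing to the order dual, as a functor from bounded distributive join-semilattices to
bounded distributive meet-semilattices. -/
def dualFunctor : BDJS.{u} ⥤ BDMSP.{u} where
  obj J := ⟨(J : Type u)ᵒᵈ, J.distrib.dual⟩
  map {_ K} f :=
    { toInfTopHom := SupBotHom.dual f.toSupBotHom
      liftsUpperBounds := (liftsUpperBounds_dual_iff K.distrib _).2 f.isPrimeIdeal_preimage }

instance : dualFunctor.{u}.Faithful where
  map_injective h := Hom.ext (DFunLike.ext _ _ (BDMSP.Hom.apply_eq_of_eq h))

instance : dualFunctor.{u}.Full where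
  map_surjective {_ K} g :=
    ⟨⟨SupBotHom.dual.symm g.toInfTopHom,
      (liftsUpperBounds_dual_iff K.distrib _).1 g.liftsUpperBounds⟩, rfl⟩

instance : dualFunctor.{u}.EssSurj where
  mem_essImage M :=
    ⟨⟨(M : Type u)ᵒᵈ, M.distrib.dual⟩,
      ⟨BDMSP.isoOfOrderIso (OrderIso.dualDual (M : Type u)).symm⟩⟩

instance : dualFunctor.{u}.IsEquivalence where

end BDJS

/-! ### Compact elements of algebraic lattices -/

section CompactElements

variable {α β : Type*} [CompleteLattice α] [CompleteLattice β]

theorem isCompactElement_bot : IsCompactElement (⊥ : α) := fun _ _ hs _ _ _ =>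
  ⟨hs.some, hs.some_mem, bot_le⟩

theorem isCompactElement_sup {a b : α} (ha : IsCompactElement a) (hb : IsCompactElement b) :
    IsCompactElement (a ⊔ b) := by
  intro s u hs hdir hu hab
  obtain ⟨x, hx, hax⟩ := ha s u hs hdir hu (le_sup_left.trans hab)
  obtain ⟨y, hy, hby⟩ := hb s u hs hdir hu (le_sup_right.trans hab)
  obtain ⟨z, hz, hxz, hyz⟩ := hdir x hx y hy
  exact ⟨z, hz, sup_le (hax.trans hxz) (hby.trans hyz)⟩

/-- The compact elements of a complete lattice, a join-semilattice with bottom element. -/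
abbrev CompactElements (α : Type*) [CompleteLattice α] : Type _ := {k : α // IsCompactElement k}

instance : SemilatticeSup (CompactElements α) :=
  Subtype.semilatticeSup fun _ _ => isCompactElement_sup

instance : OrderBot (CompactElements α) where
  bot := ⟨⊥, isCompactElement_bot⟩
  bot_le k := bot_le (a := (k : α))

/-- The inclusion of the compact elements into the lattice. -/
def compactInclusion (α : Type*) [CompleteLattice α] : SupBotHom (CompactElements α) α where
  toFun := (↑)
  map_sup' _ _ := rfl
  map_bot' := rfl

theorem exists_mem_le_of_le_sSup_image {ι : Type*} [SemilatticeSup ι] {φ : ι → β} (hφ : Monotone φ)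
    {D : Set ι} (hne : D.Nonempty) (hD : ∀ ⦃i j⦄, i ∈ D → j ∈ D → i ⊔ j ∈ D) {x : β}
    (hx : IsCompactElement x) (h : x ≤ sSup (φ '' D)) : ∃ d ∈ D, x ≤ φ d := by
  have hdir : DirectedOn (· ≤ ·) (φ '' D) :=
    directedOn_image.2 ((directedOn_of_sup_mem hD).mono fun _ _ hij => hφ hij)
  simpa only [Set.exists_mem_image] using hx _ _ (hne.image φ) hdir (isLUB_sSup _) h

/-- The extension of a map from the compact elements to the whole lattice, obtained by
taking joins over the compact elements below. -/
def compactExtension (φ : CompactElements α → β) (a : α) : β :=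
  sSup (φ '' {k | (k : α) ≤ a})

theorem le_compactExtension (φ : CompactElements α → β) {k : CompactElements α} {a : α}
    (h : (k : α) ≤ a) : φ k ≤ compactExtension φ a :=
  le_sSup ⟨k, h, rfl⟩

theorem compactExtension_le {φ : CompactElements α → β} {a : α} {b : β}
    (h : ∀ k : CompactElements α, (k : α) ≤ a → φ k ≤ b) : compactExtension φ a ≤ b :=
  sSup_le (Set.forall_mem_image.2 h)

theorem compactExtension_coe {φ : CompactElements α → β} (hφ : Monotone φ)
    (k : CompactElements α) : compactExtension φ (k : α) = φ k :=
  le_antisymm (compactExtension_le fun _ hl => hφ hl) (le_compactExtension φ le_rfl)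

theorem exists_le_of_le_compactExtension {φ : CompactElements α → β} (hφ : Monotone φ) {x : β}
    (hx : IsCompactElement x) {a : α} (h : x ≤ compactExtension φ a) :
    ∃ k : CompactElements α, (k : α) ≤ a ∧ x ≤ φ k :=
  exists_mem_le_of_le_sSup_image hφ (D := {k | (k : α) ≤ a}) ⟨⊥, bot_le (a := a)⟩
    (fun _ _ hk hl => sup_le hk hl) hx h

theorem compactExtension_comp_coe [IsCompactlyGenerated α] (f : sSupHom α β) (a : α) :
    compactExtension (fun k => f k) a = f a := by
  refine le_antisymm (compactExtension_le fun k hk => OrderHomClass.mono f hk) ?_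
  rw [← sSup_compact_le_eq a, map_sSup, sSup_compact_le_eq]
  exact sSup_le (Set.forall_mem_image.2 fun k hk =>
    le_compactExtension (fun k : CompactElements α => f k) (k := ⟨k, hk.1⟩) hk.2)

-- A join-preserving extension is a left adjoint, with right adjoint computed on compact elements.
theorem gc_compactExtension [IsCompactlyGenerated α] (φ : SupBotHom (CompactElements α) β) :
    GaloisConnection (compactExtension φ)
      fun b => sSup (Subtype.val '' {d : CompactElements α | φ d ≤ b}) := by
  refine fun a b => ⟨fun h => le_iff_compact_le_imp.2 fun k hk hka => ?_,
    fun h => compactExtension_le fun k hk => ?_⟩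
  · exact le_sSup ⟨⟨k, hk⟩, (le_compactExtension φ hka).trans h, rfl⟩
  · obtain ⟨d, hd, hkd⟩ := exists_mem_le_of_le_sSup_image (D := {d : CompactElements α | φ d ≤ b})
      (Subtype.mono_coe _) ⟨⊥, (map_bot φ).trans_le bot_le⟩
      (fun i j hi hj => (map_sup φ i j).trans_le (sup_le hi hj)) k.2 (hk.trans h)
    exact (OrderHomClass.mono φ (show k ≤ d from hkd)).trans hd

theorem exists_compact_le_sup_of_le_sup [IsCompactlyGenerated α] {x a b : α}
    (hx : IsCompactElement x) (h : x ≤ a ⊔ b) :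
    ∃ k : CompactElements α, (k : α) ≤ a ∧ x ≤ (k : α) ⊔ b := by
  let φ (k : CompactElements α) : α := (k : α) ⊔ b
  have hab : a ⊔ b ≤ compactExtension φ a := sup_le
    (le_iff_compact_le_imp.2 fun k hk hka =>
      le_sup_left.trans (le_compactExtension φ (k := ⟨k, hk⟩) hka))
    (le_sup_right.trans (le_compactExtension φ (k := ⊥) bot_le))
  exact exists_le_of_le_compactExtension (fun _ _ hkl => sup_le_sup_right hkl b) hx (h.trans hab)

theorem isDistribJoinSemilattice_compactElements {α : Type u} [Order.Frame α]
    [IsCompactlyGenerated α] : IsDistribJoinSemilattice (CompactElements α) := by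
  intro a b c hc
  have hcab : (c : α) ≤ ((c : α) ⊓ a) ⊔ ((c : α) ⊓ b) := by
    rw [← inf_sup_left]
    exact le_inf le_rfl hc
  obtain ⟨k, hk, hck⟩ := exists_compact_le_sup_of_le_sup c.2 hcab
  obtain ⟨l, hl, hcl⟩ := exists_compact_le_sup_of_le_sup c.2 (hck.trans_eq (sup_comm _ _))
  exact ⟨k, l, hk.trans inf_le_right, hl.trans inf_le_right, Subtype.ext (le_antisymm
    (sup_le (hk.trans inf_le_left) (hl.trans inf_le_left)) (hcl.trans_eq (sup_comm _ _)))⟩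

/-- The order dual of `LiftsUpperBounds`: whenever `S` is finite and `x` is a lower bound of the
image of `S`, there is a lower bound `c` of `S` with `x ≤ φ c`. -/
def LiftsLowerBounds {ι κ : Type*} [Preorder ι] [Preorder κ] (φ : ι → κ) : Prop :=
  ∀ S : Set ι, S.Finite → ∀ x ∈ lowerBounds (φ '' S), ∃ c ∈ lowerBounds S, x ≤ φ c

/-- The restriction to compact elements of a frame homomorphism that preserves compactness. -/
def compactRestriction (f : FrameHom α β) (hf : ∀ k, IsCompactElement k → IsCompactElement (f k)) :
    SupBotHom (CompactElements α) (CompactElements β) where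
  toFun k := ⟨f k, hf k k.2⟩
  map_sup' a b := Subtype.ext (map_sup f (a : α) b)
  map_bot' := Subtype.ext (map_bot f)

theorem liftsLowerBounds_compactRestriction [IsCompactlyGenerated α] (f : FrameHom α β)
    (hf : ∀ k, IsCompactElement k → IsCompactElement (f k)) :
    LiftsLowerBounds (compactRestriction f hf) := by
  intro S hS x hx
  have hxS : (x : β) ≤ f (hS.toFinset.inf (↑)) := by
    rw [map_finset_inf]
    exact Finset.le_inf fun s hs => hx ⟨s, hS.mem_toFinset.1 hs, rfl⟩
  obtain ⟨k, hkS, hxk⟩ := exists_le_of_le_compactExtension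
    (fun _ _ hkl => OrderHomClass.mono f hkl) x.2
    (hxS.trans_eq (compactExtension_comp_coe (f : sSupHom α β) _).symm)
  exact ⟨k, fun s hs => hkS.trans (Finset.inf_le (hS.mem_toFinset.2 hs)), hxk⟩

section Extend

variable {φ : SupBotHom (CompactElements α) (CompactElements β)}

theorem compactExtension_inf [IsCompactlyGenerated β] (hφ : LiftsLowerBounds φ) (a b : α) :
    compactExtension ((compactInclusion β).comp φ) (a ⊓ b) =
      compactExtension ((compactInclusion β).comp φ) a ⊓
        compactExtension ((compactInclusion β).comp φ) b := by
  have hmono := OrderHomClass.mono ((compactInclusion β).comp φ)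
  refine le_antisymm (le_inf ?_ ?_) (le_iff_compact_le_imp.2 fun x hx hxab => ?_)
  · exact compactExtension_le fun k hk => le_compactExtension _ (hk.trans inf_le_left)
  · exact compactExtension_le fun k hk => le_compactExtension _ (hk.trans inf_le_right)
  obtain ⟨k, hk, hxk⟩ := exists_le_of_le_compactExtension hmono hx (hxab.trans inf_le_left)
  obtain ⟨l, hl, hxl⟩ := exists_le_of_le_compactExtension hmono hx (hxab.trans inf_le_right)
  obtain ⟨c, hc, hxc⟩ := hφ {k, l} (Set.toFinite _) ⟨x, hx⟩ (by
    rintro _ ⟨_, rfl | rfl, rfl⟩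
    exacts [hxk, hxl])
  have hck : (c : α) ≤ k := hc (Set.mem_insert k {l})
  have hcl : (c : α) ≤ l := hc (Set.mem_insert_of_mem k rfl)
  exact le_trans hxc (le_compactExtension ((compactInclusion β).comp φ)
    (le_inf (hck.trans hk) (hcl.trans hl)))

theorem compactExtension_top (hβ : IsCompactElement (⊤ : β)) (hφ : LiftsLowerBounds φ) :
    compactExtension ((compactInclusion β).comp φ) ⊤ = ⊤ := by
  obtain ⟨c, -, hc⟩ := hφ ∅ Set.finite_empty ⟨⊤, hβ⟩ (by simp)
  exact top_le_iff.1 (le_trans hc (le_compactExtension ((compactInclusion β).comp φ) le_top))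

variable [IsCompactlyGenerated α] [IsCompactlyGenerated β]

/-- The frame homomorphism extending a map of compact elements that lifts lower bounds. -/
def compactExtensionHom (hβ : IsCompactElement (⊤ : β))
    (hφ : LiftsLowerBounds φ) : FrameHom α β where
  toFun := compactExtension ((compactInclusion β).comp φ)
  map_inf' := compactExtension_inf hφ
  map_top' := compactExtension_top hβ hφ
  map_sSup' _ := (gc_compactExtension ((compactInclusion β).comp φ)).l_sSup.trans sSup_image.symm

theorem compactExtensionHom_coe (hβ : IsCompactElement (⊤ : β))
    (hφ : LiftsLowerBounds φ) (k : CompactElements α) :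
    compactExtensionHom hβ hφ (k : α) = φ k :=
  compactExtension_coe (OrderHomClass.mono ((compactInclusion β).comp φ)) k

end Extend

end CompactElements

namespace KAlgFrm

instance (L : KAlgFrm.{u}) : BoundedOrder (CompactElements L) where
  top := ⟨⊤, L.isCompactElement_top⟩
  le_top k := le_top (a := (k : L))

/-- The functor sending a compact algebraic frame to its compact elements under the reverse
order. -/
def compactsFunctor : KAlgFrm.{u} ⥤ BDMSP.{u} where
  obj L := ⟨(CompactElements L)ᵒᵈ, isDistribJoinSemilattice_compactElements.dual⟩
  map f :=
    { toInfTopHom := SupBotHom.dual (compactRestriction f.toFrameHom f.map_isCompactElement)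
      liftsUpperBounds := liftsLowerBounds_compactRestriction f.toFrameHom f.map_isCompactElement }

instance : compactsFunctor.{u}.Faithful where
  map_injective {L M f g} h := by
    have hfg (k : CompactElements L) : f.toFrameHom k = g.toFrameHom k :=
      congrArg Subtype.val (BDMSP.Hom.apply_eq_of_eq h (OrderDual.toDual k))
    refine Hom.ext (DFunLike.ext _ _ fun (a : L) => ?_)
    calc f.toFrameHom a
      _ = compactExtension (fun k => f.toFrameHom k) a :=
        (compactExtension_comp_coe (f.toFrameHom : sSupHom L M) a).symm
      _ = compactExtension (fun k => g.toFrameHom k) a := by rw [funext hfg]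
      _ = g.toFrameHom a := compactExtension_comp_coe (g.toFrameHom : sSupHom L M) a

instance : compactsFunctor.{u}.Full where
  map_surjective {L M} g := by
    let φ : SupBotHom (CompactElements L) (CompactElements M) := SupBotHom.dual.symm g.toInfTopHom
    have hφ : LiftsLowerBounds φ := g.liftsUpperBounds
    let f := compactExtensionHom M.isCompactElement_top hφ
    have hf (k : CompactElements L) : f k = φ k := compactExtensionHom_coe _ hφ k
    exact ⟨⟨f, fun k hk => hf ⟨k, hk⟩ ▸ (φ ⟨k, hk⟩).2⟩,
      BDMSP.Hom.ext (DFunLike.ext _ _ fun k => Subtype.ext (hf (OrderDual.ofDual k)))⟩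

end KAlgFrm

/-! ### Frames of ideals -/

section Ideals

open Order Order.Ideal

variable {J : Type u} [SemilatticeSup J]

theorem isLUB_principal_image (I : Ideal J) : IsLUB (principal '' (I : Set J)) I :=
  ⟨Set.forall_mem_image.2 fun _ ha => principal_le_iff.2 ha,
    fun _ hK a ha => principal_le_iff.1 (hK ⟨a, ha, rfl⟩)⟩

variable [OrderBot J]

theorem isCompactElement_principal (a : J) : IsCompactElement (principal a) := by
  rw [CompleteLattice.isCompactElement_iff_le_of_directed_sSup_le]
  intro S hS hdir ha
  have hI : IsIdeal (⋃₀ ((↑) '' S : Set (Set J))) :=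
    isIdeal_sUnion_of_directedOn (Set.forall_mem_image.2 fun I _ => I.isIdeal)
      (directedOn_image.2 hdir) (hS.image _)
  have hle : sSup S ≤ hI.toIdeal := sSup_le fun I hIS x hx => ⟨I, ⟨I, hIS, rfl⟩, hx⟩
  obtain ⟨_, ⟨I, hIS, rfl⟩, haI⟩ := hle (ha (mem_principal_self (x := a)))
  exact ⟨I, hIS, principal_le_iff.2 haI⟩

theorem isCompactElement_ideal_iff {I : Ideal J} :
    IsCompactElement I ↔ ∃ a, principal a = I := by
  refine ⟨fun hI => ?_, fun ⟨a, ha⟩ => ha ▸ isCompactElement_principal a⟩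
  have hmono : Monotone (principal : J → Ideal J) := fun _ _ hab => principal_le_iff.2 hab
  obtain ⟨a, ha, hIa⟩ := exists_mem_le_of_le_sSup_image hmono I.nonempty
    (fun _ _ => sup_mem) hI (isLUB_principal_image I).sSup_eq.ge
  exact ⟨a, le_antisymm (principal_le_iff.2 ha) hIa⟩

instance : IsCompactlyGenerated (Ideal J) where
  exists_sSup_eq I := ⟨_, Set.forall_mem_image.2 fun a _ => isCompactElement_principal a,
    (isLUB_principal_image I).sSup_eq⟩

/-- The isomorphism between a join-semilattice with bottom element and the compact elements of its
lattice of ideals. -/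
noncomputable def compactElementsIdealIso (J : Type u) [SemilatticeSup J] [OrderBot J] :
    J ≃o CompactElements (Ideal J) :=
  RelIso.ofSurjective
    (OrderEmbedding.ofMapLEIff (fun a => ⟨principal a, isCompactElement_principal a⟩)
      fun _ _ => principal_le_iff)
    fun I => (isCompactElement_ideal_iff.1 I.2).imp fun _ => Subtype.ext

/-- The Heyting implication in the lattice of ideals of a distributive join-semilattice. -/
def idealHImp (hJ : IsDistribJoinSemilattice J) (I B : Ideal J) : Ideal J where
  carrier := {x | ∀ y ≤ x, y ∈ I → y ∈ B}
  lower' _ _ hzx hx y hy := hx y (hy.trans hzx)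
  nonempty' := ⟨⊥, fun _ hy _ => B.lower hy (bot_mem B)⟩
  directed' x hx z hz := by
    refine ⟨x ⊔ z, fun y hy hyI => ?_, le_sup_left, le_sup_right⟩
    obtain ⟨x', z', hx', hz', rfl⟩ := hJ _ _ _ hy
    exact sup_mem (hx _ hx' (I.lower le_sup_left hyI)) (hz _ hz' (I.lower le_sup_right hyI))

theorem le_idealHImp_iff (hJ : IsDistribJoinSemilattice J) {I B K : Ideal J} :
    K ≤ idealHImp hJ I B ↔ I ⊓ K ≤ B :=
  ⟨fun h x hx => h hx.2 x le_rfl hx.1, fun h _ hx _ hyx hyI => h ⟨hyI, K.lower hyx hx⟩⟩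

/-- The frame of ideals of a distributive join-semilattice. -/
abbrev idealFrame (hJ : IsDistribJoinSemilattice J) : Frame (Ideal J) :=
  .ofMinimalAxioms
    { inf_sSup_le_iSup_inf := fun I S => (le_idealHImp_iff hJ).1 <| sSup_le fun K hK =>
        (le_idealHImp_iff hJ).2 (le_iSup₂ (f := fun K (_ : K ∈ S) => I ⊓ K) K hK) }

end Ideals

/-- The compact algebraic frame of filters of a bounded distributive meet-semilattice, realized as
ideals of the order dual. -/
def BDMSP.filterFrame (M : BDMSP.{u}) : KAlgFrm.{u} :=
  letI := idealFrame M.distrib.dual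
  { carrier := Order.Ideal (M : Type u)ᵒᵈ
    isCompactElement_top := isCompactElement_ideal_iff.2 ⟨⊤, Order.Ideal.principal_top⟩ }

namespace KAlgFrm

instance : compactsFunctor.{u}.EssSurj where
  mem_essImage M :=
    ⟨M.filterFrame, ⟨BDMSP.isoOfOrderIso ((OrderIso.dualDual (M : Type u)).trans
      (compactElementsIdealIso (M : Type u)ᵒᵈ).dual).symm⟩⟩

instance : compactsFunctor.{u}.IsEquivalence where

end KAlgFrm

/-! ### Admissible clopen upsets -/

section Maximal

variable {X : Type*} [TopologicalSpace X]

instance [Preorder X] [PriestleySpace X] : ClosedIciTopology X where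
  isClosed_Ici _ := isOpen_compl_iff.1 <| isOpen_iff_forall_mem_open.2 fun _ hz =>
    let ⟨U, hU, hUup, hyU, hzU⟩ := exists_isClopen_upper_of_not_le hz
    ⟨Uᶜ, fun _ hw hyw => hw (hUup hyw hyU), hU.compl.isOpen, hzU⟩

theorem exists_mem_upperBounds_of_isCompact [Preorder X] [ClosedIciTopology X] {C D : Set X}
    (hC : IsCompact C) (hD : DirectedOn (· ≤ ·) D) (hne : D.Nonempty) (hDC : D ⊆ C) :
    ∃ z ∈ C, z ∈ upperBounds D := by
  obtain ⟨z, hz, hzD⟩ := hC.inter_iInter_nonempty (fun d : D => Set.Ici (d : X))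
    (fun _ => isClosed_Ici) fun S => by
      obtain ⟨d, hd, hdS⟩ := exists_mem_upperBounds_of_directedOn hD hne
        (S.finite_toSet.image Subtype.val) (Set.image_subset_iff.2 fun s _ => s.2)
      exact ⟨d, hDC hd, Set.mem_iInter₂.2 fun s hs => hdS ⟨s, hs, rfl⟩⟩
  exact ⟨z, hz, fun d hd => Set.mem_iInter.1 hzD ⟨d, hd⟩⟩

theorem exists_le_maximal_of_isCompact [PartialOrder X] [ClosedIciTopology X] {C : Set X}
    (hC : IsCompact C) {x : X} (hx : x ∈ C) : ∃ m, x ≤ m ∧ Maximal (· ∈ C) m :=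
  zorn_le_nonempty₀ C (fun _ hcC hchain _ hy =>
    exists_mem_upperBounds_of_isCompact hC hchain.directedOn ⟨_, hy⟩ hcC) x hx

theorem isClopen_setOf_mem_iff {U : Set X} (hU : IsClopen U) (p : Prop) :
    IsClopen {y | y ∈ U ↔ p} := by
  by_cases hp : p
  · simpa only [hp, iff_true, Set.ofPred_mem_eq] using hU
  · simpa only [hp, iff_false, Set.compl_def] using hU.compl

end Maximal

section Admissible

variable {X : Type u} [TopologicalSpace X] [PartialOrder X] {X₀ : Set X}

/-- The admissible clopen upsets relative to a subset. -/
abbrev AdmissibleUpset (X₀ : Set X) : Type u := {U : Set X // IsAdmissible X₀ U}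

theorem IsAdmissible.inter {U V : Set X} (hU : IsAdmissible X₀ U) (hV : IsAdmissible X₀ V) :
    IsAdmissible X₀ (U ∩ V) where
  isClopen := hU.isClopen.inter hV.isClopen
  isUpperSet := hU.isUpperSet.inter hV.isUpperSet
  maximal_mem x hx := by
    by_cases hxU : x ∈ U
    · exact hV.maximal_mem x ⟨fun hxV => hx.prop ⟨hxU, hxV⟩,
        fun y hy hxy => hx.le_of_ge (fun h => hy h.2) hxy⟩
    · exact hU.maximal_mem x ⟨hxU, fun y hy hxy => hx.le_of_ge (fun h => hy h.1) hxy⟩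

theorem isAdmissible_univ : IsAdmissible X₀ Set.univ :=
  ⟨isClopen_univ, isUpperSet_univ, fun x hx => (hx.prop (Set.mem_univ x)).elim⟩

instance : SemilatticeInf (AdmissibleUpset X₀) :=
  Subtype.semilatticeInf fun _ _ => IsAdmissible.inter

instance : OrderTop (AdmissibleUpset X₀) where
  top := ⟨Set.univ, isAdmissible_univ⟩
  le_top U := Set.subset_univ U.1

/-- The filter of admissible clopen upsets containing a given point. -/
def pointFilter (X₀ : Set X) (x : X) : Set (AdmissibleUpset X₀) := {U | x ∈ U.1}

theorem isPFilter_pointFilter (x : X) : Order.IsPFilter (pointFilter X₀ x) :=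
  isPFilter_iff.2 ⟨fun _ _ hUV hx => hUV hx, Set.mem_univ x, fun _ hU _ hV => ⟨hU, hV⟩⟩

theorem directedOn_compl_pointFilter_iff {x : X} :
    DirectedOn (· ≤ ·) (pointFilter X₀ x)ᶜ ↔
      DirectedOn (· ⊆ ·) {U | IsAdmissible X₀ U ∧ x ∉ U} := by
  have himage : {U | IsAdmissible X₀ U ∧ x ∉ U} = Subtype.val '' (pointFilter X₀ x)ᶜ :=
    Set.ext fun U => ⟨fun ⟨hU, hx⟩ => ⟨⟨U, hU⟩, hx, rfl⟩, fun ⟨V, hx, hV⟩ => hV ▸ ⟨V.2, hx⟩⟩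
  rw [himage, directedOn_image]
  rfl

variable [CompactSpace X]

theorem exists_pointFilter_eq {P : Set (AdmissibleUpset X₀)} (hP : IsOptimalFilter P) :
    ∃ x, pointFilter X₀ x = P := by
  have hclosed (U : AdmissibleUpset X₀) : IsClosed {y | y ∈ U.1 ↔ U ∈ P} :=
    (isClopen_setOf_mem_iff U.2.isClopen _).isClosed
  obtain ⟨x, hx⟩ := CompactSpace.iInter_nonempty hclosed fun I => by
    obtain ⟨A, C, hAC, hI⟩ := hP.exists_not_le I
    obtain ⟨y, hyA, hyC⟩ := Set.not_subset.1 hAC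
    refine ⟨y, Set.mem_iInter₂.2 fun U hU => ⟨fun hyU => ?_, fun hUP => (hI U hU).1 hUP hyA⟩⟩
    by_contra hUP
    exact hyC ((hI U hU).2 hUP hyU)
  exact ⟨x, Set.ext fun U => Set.mem_iInter.1 hx U⟩

variable [PriestleySpace X]

theorem exists_finset_inf_le {ι : Type*} (g : ι → AdmissibleUpset X₀) (W : AdmissibleUpset X₀)
    (h : ∀ x ∈ X₀, x ∉ W.1 → ∃ i, x ∉ (g i).1) : ∃ T : Finset ι, T.inf g ≤ W := by
  have hcompact : IsCompact W.1ᶜ := W.2.isClopen.compl.isClosed.isCompact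
  obtain ⟨T, hT⟩ := hcompact.elim_finite_subcover
    (fun i => (g i).1ᶜ) (fun i => (g i).2.isClopen.compl.isOpen) fun x hx => by
      obtain ⟨m, hxm, hm⟩ := exists_le_maximal_of_isCompact hcompact hx
      obtain ⟨i, hi⟩ := h m (W.2.maximal_mem m hm) hm.prop
      exact Set.mem_iUnion.2 ⟨i, fun hxi => hi ((g i).2.isUpperSet hxm hxi)⟩
  refine ⟨T, fun x hx => ?_⟩
  by_contra hxW
  obtain ⟨i, hi, hxi⟩ := Set.mem_iUnion₂.1 (hT hxW)
  have hle : T.inf g ≤ g i := Finset.inf_le hi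
  exact hxi (hle hx)

theorem isDistribMeetSemilattice_admissibleUpset
    (hX₀ : ∀ x ∈ X₀, DirectedOn (· ≤ ·) (pointFilter X₀ x)ᶜ) :
    IsDistribMeetSemilattice (AdmissibleUpset X₀) := by
  classical
  intro U V W hUVW
  let ι := {C : AdmissibleUpset X₀ // W ≤ C ∧ (U ≤ C ∨ V ≤ C)}
  obtain ⟨T, hT⟩ := exists_finset_inf_le (fun C : ι => C.1) W fun x hx hxW => by
    have hxUV : x ∉ U.1 ∨ x ∉ V.1 := by
      by_contra! h
      exact hxW (hUVW h)
    rcases hxUV with h | h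
    · obtain ⟨C, hC, hUC, hWC⟩ := hX₀ x hx U h W hxW
      exact ⟨⟨C, hWC, .inl hUC⟩, hC⟩
    · obtain ⟨C, hC, hVC, hWC⟩ := hX₀ x hx V h W hxW
      exact ⟨⟨C, hWC, .inr hVC⟩, hC⟩
  refine ⟨{i ∈ T | U ≤ i.1}.inf Subtype.val, {i ∈ T | V ≤ i.1}.inf Subtype.val,
    Finset.le_inf fun i hi => (Finset.mem_filter.1 hi).2,
    Finset.le_inf fun i hi => (Finset.mem_filter.1 hi).2,
    le_antisymm (le_trans (Finset.le_inf fun i hi => ?_) hT)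
      (le_inf (Finset.le_inf fun i _ => i.2.1) (Finset.le_inf fun i _ => i.2.1))⟩
  rcases i.2.2 with h | h
  · exact inf_le_left.trans (Finset.inf_le (Finset.mem_filter.2 ⟨hi, h⟩))
  · exact inf_le_right.trans (Finset.inf_le (Finset.mem_filter.2 ⟨hi, h⟩))

end Admissible

namespace GPSP

variable {X Y : GPSP.{u}}

theorem isAdmissible_empty (X : GPSP.{u}) : IsAdmissible X.core ∅ where
  isClopen := isClopen_empty
  isUpperSet := isUpperSet_empty
  maximal_mem x hx := by
    obtain ⟨y, hy, hxy⟩ := X.exists_le_core x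
    rwa [hx.eq_of_le (Set.notMem_empty y) hxy]

instance : BoundedOrder (AdmissibleUpset X.core) where
  bot := ⟨∅, X.isAdmissible_empty⟩
  bot_le U := Set.empty_subset U.1

theorem mem_core_iff_isPrimeFilter {x : X} :
    x ∈ X.core ↔ IsPrimeFilter (pointFilter X.core x) := by
  rw [X.mem_core_iff, ← directedOn_compl_pointFilter_iff, isPrimeFilter_iff_directedOn_compl]
  exact ⟨fun h => ⟨isPFilter_pointFilter x, ⟨⊥, Set.notMem_empty x⟩, h⟩, fun h => h.2.2⟩

theorem isOptimalFilter_pointFilter (x : X) : IsOptimalFilter (pointFilter X.core x) := by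
  refine isOptimalFilter_of_forall_finset fun I => ?_
  have hopen : IsOpen (⋂ U ∈ I, {y | y ∈ U.1 ↔ x ∈ U.1}) :=
    isOpen_biInter_finset fun U _ => (isClopen_setOf_mem_iff U.2.isClopen _).isOpen
  obtain ⟨y, hyI, hy⟩ := X.dense_core.inter_open_nonempty _ hopen
    ⟨x, Set.mem_iInter₂.2 fun _ _ => Iff.rfl⟩
  exact ⟨pointFilter X.core y, (mem_core_iff_isPrimeFilter.1 hy).isOptimalFilter,
    Set.mem_iInter₂.1 hyI⟩

theorem le_iff_pointFilter_subset {x y : X} :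
    x ≤ y ↔ pointFilter X.core x ⊆ pointFilter X.core y :=
  (X.le_iff x y).trans ⟨fun h U => h U.1 U.2, fun h U hU => @h ⟨U, hU⟩⟩

/-- The bounded distributive meet-semilattice of admissible clopen upsets. -/
def admissibleUpsets (X : GPSP.{u}) : BDMSP.{u} :=
  ⟨AdmissibleUpset X.core, isDistribMeetSemilattice_admissibleUpset fun _ hx =>
    (mem_core_iff_isPrimeFilter.1 hx).directedOn_compl⟩

/-- The inverse image map on admissible clopen upsets. -/
def Hom.preimage (f : Hom X Y) :
    InfTopHom (AdmissibleUpset Y.core) (AdmissibleUpset X.core) where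
  toFun U := ⟨f.toOrderHom ⁻¹' U, f.isAdmissible_preimage U U.2⟩
  map_inf' _ _ := rfl
  map_top' := rfl

theorem Hom.liftsUpperBounds_preimage (f : Hom X Y) : LiftsUpperBounds f.preimage :=
  liftsUpperBounds_of_isPrimeFilter_preimage X.admissibleUpsets.distrib
    (OrderHomClass.mono f.preimage) fun P hP => by
      obtain ⟨x, rfl⟩ := exists_pointFilter_eq hP.isOptimalFilter
      exact mem_core_iff_isPrimeFilter.1 (f.map_core x (mem_core_iff_isPrimeFilter.2 hP))

/-- The functor sending a generalized Priestley space to its admissible clopen upsets. -/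
def admissibleFunctor : GPSP.{u}ᵒᵖ ⥤ BDMSP.{u} where
  obj X := X.unop.admissibleUpsets
  map f := ⟨Hom.preimage f.unop, Hom.liftsUpperBounds_preimage f.unop⟩

instance : admissibleFunctor.{u}.Faithful where
  map_injective {X Y f g} h := by
    have hfg (x : Y.unop) : pointFilter X.unop.core (f.unop.toOrderHom x) =
        pointFilter X.unop.core (g.unop.toOrderHom x) := Set.ext fun U =>
      Set.ext_iff.1 (congrArg Subtype.val (BDMSP.Hom.apply_eq_of_eq h U)) x
    exact Quiver.Hom.unop_inj (Hom.ext (OrderHom.ext _ _ (funext fun x =>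
      le_antisymm (le_iff_pointFilter_subset.2 (hfg x).subset)
        (le_iff_pointFilter_subset.2 (hfg x).superset))))

theorem exists_hom_preimage_eq
    {α : InfTopHom (AdmissibleUpset Y.core) (AdmissibleUpset X.core)} (hα : LiftsUpperBounds α) :
    ∃ f : Hom X Y, f.preimage = α := by
  choose f hf using fun x => exists_pointFilter_eq ((isOptimalFilter_pointFilter x).preimage hα)
  have hpreimage (U : AdmissibleUpset Y.core) : f ⁻¹' U.1 = (α U).1 :=
    Set.ext fun x => Set.ext_iff.1 (hf x) U
  have hmono : Monotone f := fun x y hxy => le_iff_pointFilter_subset.2 <| by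
    rw [hf, hf]
    exact Set.preimage_mono (le_iff_pointFilter_subset.1 hxy)
  have hadm (U : Set Y) (hU : IsAdmissible Y.core U) : IsAdmissible X.core (f ⁻¹' U) :=
    hpreimage ⟨U, hU⟩ ▸ (α ⟨U, hU⟩).2
  have hcore (x : X) (hx : x ∈ X.core) : f x ∈ Y.core := mem_core_iff_isPrimeFilter.2 <| by
    rw [hf]
    exact (mem_core_iff_isPrimeFilter.1 hx).preimage hα
  exact ⟨⟨⟨f, hmono⟩, hadm, hcore⟩, DFunLike.ext _ _ fun U => Subtype.ext (hpreimage U)⟩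

instance : admissibleFunctor.{u}.Full where
  map_surjective g := by
    obtain ⟨f, hf⟩ := exists_hom_preimage_eq g.liftsUpperBounds
    exact ⟨Quiver.Hom.op f, BDMSP.Hom.ext hf⟩

end GPSP

/-! ### The space of optimal filters -/

theorem mem_closure_pi_iff_forall_finset {ι : Type*} {κ : ι → Type*}
    [∀ i, TopologicalSpace (κ i)] [∀ i, DiscreteTopology (κ i)] {S : Set (∀ i, κ i)}
    {p : ∀ i, κ i} : p ∈ closure S ↔ ∀ I : Finset ι, ∃ q ∈ S, ∀ i ∈ I, q i = p i := by
  refine ⟨fun hp I => ?_, fun h => mem_closure_iff.2 fun U hU hpU => ?_⟩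
  · obtain ⟨q, hqp, hqS⟩ := mem_closure_iff.1 hp (Set.pi I fun i => {p i})
      (isOpen_set_pi I.finite_toSet fun i _ => isOpen_discrete _) fun _ _ => rfl
    exact ⟨q, hqS, hqp⟩
  · obtain ⟨I, v, hv, hvU⟩ := isOpen_pi_iff.1 hU p hpU
    obtain ⟨q, hqS, hqp⟩ := h I
    exact ⟨q, hvU fun i hi => (hqp i hi).symm ▸ (hv i hi).2, hqS⟩

/-- The optimal filters of a meet-semilattice, ordered by inclusion. -/
abbrev OptimalFilter (M : Type u) [SemilatticeInf M] : Type u := {P : Set M // IsOptimalFilter P}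

namespace OptimalFilter

section Topology

variable {M : Type u} [SemilatticeInf M]

noncomputable instance : TopologicalSpace (OptimalFilter M) :=
  .induced (fun P => P.1.boolIndicator) inferInstance

theorem isInducing_boolIndicator :
    Topology.IsInducing fun P : OptimalFilter M => P.1.boolIndicator :=
  ⟨rfl⟩

theorem isClopen_setOf_mem (a : M) : IsClopen {P : OptimalFilter M | a ∈ P.1} := by
  simp only [Set.mem_iff_boolIndicator]
  exact (isClopen_discrete {true}).preimage
    ((continuous_apply a).comp isInducing_boolIndicator.continuous)

theorem isUpperSet_setOf_mem (a : M) : IsUpperSet {P : OptimalFilter M | a ∈ P.1} :=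
  fun _ _ hPQ ha => hPQ ha

instance : PriestleySpace (OptimalFilter M) where
  priestley hPQ := by
    obtain ⟨a, haP, haQ⟩ := Set.not_subset.1 hPQ
    exact ⟨_, isClopen_setOf_mem a, isUpperSet_setOf_mem a, haP, haQ⟩

theorem mem_closure_iff_forall_finset {S : Set (OptimalFilter M)} {P : OptimalFilter M} :
    P ∈ closure S ↔ ∀ I : Finset M, ∃ Q ∈ S, ∀ a ∈ I, a ∈ Q.1 ↔ a ∈ P.1 := by
  have hagree (Q : OptimalFilter M) (a : M) :
      Q.1.boolIndicator a = P.1.boolIndicator a ↔ (a ∈ Q.1 ↔ a ∈ P.1) := by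
    rw [Set.mem_iff_boolIndicator Q.1, Set.mem_iff_boolIndicator P.1, Bool.coe_iff_coe]
  rw [isInducing_boolIndicator.closure_eq_preimage_closure_image, Set.mem_preimage,
    mem_closure_pi_iff_forall_finset]
  simp only [Set.exists_mem_image, hagree]

instance [OrderTop M] : CompactSpace (OptimalFilter M) := by
  have hclosed : IsClosed (Set.range fun P : OptimalFilter M => P.1.boolIndicator) := by
    refine isClosed_of_closure_subset fun p hp => ?_
    have hoptimal : IsOptimalFilter {a | p a = true} :=
      isOptimalFilter_of_forall_finset fun I => by
        obtain ⟨_, ⟨Q, rfl⟩, hQ⟩ := mem_closure_pi_iff_forall_finset.1 hp I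
        exact ⟨Q.1, Q.2, fun a ha =>
          (Set.mem_iff_boolIndicator _ a).trans (Bool.eq_iff_iff.1 (hQ a ha))⟩
    exact ⟨⟨_, hoptimal⟩, funext fun a => Bool.eq_iff_iff.2 (Set.mem_iff_boolIndicator _ a).symm⟩
  rw [← isCompact_univ_iff, isInducing_boolIndicator.isCompact_iff, Set.image_univ]
  exact hclosed.isCompact

end Topology

/-- The prime filters among the optimal filters. -/
def core (M : Type u) [SemilatticeInf M] : Set (OptimalFilter M) := {P | IsPrimeFilter P.1}

section Core

variable {M : Type u} [SemilatticeInf M] {P : OptimalFilter M}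

theorem mem_core_iff_directedOn_compl [OrderBot M] :
    P ∈ core M ↔ DirectedOn (· ≤ ·) P.1ᶜ :=
  isPrimeFilter_iff_directedOn_compl.trans
    ⟨fun h => h.2.2, fun h => ⟨P.2.isPFilter, ⟨⊥, P.2.bot_notMem⟩, h⟩⟩

theorem exists_mem_core_le (hM : IsDistribMeetSemilattice M) {a : M} (ha : a ∉ P.1) :
    ∃ Q ∈ core M, P ≤ Q ∧ a ∉ Q.1 := by
  obtain ⟨Q, hQ, hPQ, haQ⟩ := exists_isPrimeFilter_notMem hM P.2.isPFilter ha
  exact ⟨⟨Q, hQ.isOptimalFilter⟩, hQ, hPQ, haQ⟩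

theorem isAdmissible_setOf_mem (hM : IsDistribMeetSemilattice M) (a : M) :
    IsAdmissible (core M) {P : OptimalFilter M | a ∈ P.1} where
  isClopen := isClopen_setOf_mem a
  isUpperSet := isUpperSet_setOf_mem a
  maximal_mem P hP := by
    obtain ⟨Q, hQ, hPQ, haQ⟩ := exists_mem_core_le hM hP.prop
    rwa [hP.eq_of_le haQ hPQ]

variable [OrderTop M]

theorem dense_core (hM : IsDistribMeetSemilattice M) : Dense (core M) := fun P =>
  mem_closure_iff_forall_finset.2 fun I =>
    let ⟨Q, hQ, hQP⟩ := P.2.exists_isPrimeFilter_mem_iff hM I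
    ⟨⟨Q, hQ.isOptimalFilter⟩, hQ, hQP⟩

/-- The set of optimal filters containing a given element, as an admissible clopen upset. -/
def basic (hM : IsDistribMeetSemilattice M) : InfTopHom M (AdmissibleUpset (core M)) where
  toFun a := ⟨_, isAdmissible_setOf_mem hM a⟩
  map_inf' _ _ := Subtype.ext <| Set.ext fun P =>
    let hup := isUpperSet_of_isPFilter P.2.isPFilter
    ⟨fun h => ⟨hup inf_le_left h, hup inf_le_right h⟩,
      fun h => inf_mem_of_isPFilter P.2.isPFilter h.1 h.2⟩
  map_top' := Subtype.ext (Set.eq_univ_of_forall fun P => (isPFilter_iff.1 P.2.isPFilter).2.1)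

variable {hM : IsDistribMeetSemilattice M}

theorem basic_le_basic_iff {a b : M} : basic hM a ≤ basic hM b ↔ a ≤ b := by
  refine ⟨fun h => ?_, fun h => OrderHomClass.mono (basic hM) h⟩
  by_contra hab
  obtain ⟨P, hP, ha, hb⟩ := exists_isPrimeFilter_of_not_le hM hab
  have hPa : ⟨P, hP.isOptimalFilter⟩ ∈ (basic hM a).1 := ha
  exact hb (h hPa)

theorem exists_le_basic {U : AdmissibleUpset (core M)} (hP : P ∈ core M) (hPU : P ∉ U.1) :
    ∃ c : M, U ≤ basic hM c ∧ P ∉ (basic hM c).1 := by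
  obtain ⟨T, hT⟩ := U.2.isClopen.isClosed.isCompact.elim_finite_subcover
    (fun b : (P.1ᶜ : Set M) => (basic hM b.1).1) (fun b => (isClopen_setOf_mem b.1).isOpen)
    fun Q hQ => by
      obtain ⟨b, hbQ, hbP⟩ := Set.not_subset.1 fun h : Q ≤ P => hPU (U.2.isUpperSet h hQ)
      exact Set.mem_iUnion.2 ⟨⟨b, hbP⟩, hbQ⟩
  obtain ⟨c, hcT, hc⟩ := (isPrimeFilter_iff_forall_finite.1 hP).2 (Subtype.val '' (T : Set _))
    (T.finite_toSet.image _) (Subtype.coe_image_subset _ _)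
  refine ⟨c, fun Q hQ => ?_, hc⟩
  obtain ⟨b, hb, hbQ⟩ := Set.mem_iUnion₂.1 (hT hQ)
  exact basic_le_basic_iff.2 (hcT ⟨b, hb, rfl⟩) hbQ

theorem basic_surjective : Function.Surjective (basic hM) := fun U => by
  obtain ⟨T, hT⟩ := exists_finset_inf_le (fun c : {c : M // U ≤ basic hM c} => basic hM c.1) U
    fun P hP hPU => by
      obtain ⟨c, hUc, hPc⟩ := exists_le_basic (hM := hM) hP hPU
      exact ⟨⟨c, hUc⟩, hPc⟩
  refine ⟨T.inf Subtype.val, ?_⟩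
  rw [map_finset_inf]
  exact le_antisymm hT (Finset.le_inf fun c _ => c.2)

/-- A distributive meet-semilattice is isomorphic to the admissible clopen upsets of its space of
optimal filters. -/
noncomputable def basicIso (hM : IsDistribMeetSemilattice M) : M ≃o AdmissibleUpset (core M) :=
  RelIso.ofSurjective (OrderEmbedding.ofMapLEIff (basic hM) fun _ _ => basic_le_basic_iff)
    (basic_surjective (hM := hM))

theorem directedOn_compl_pointFilter_core_iff (hM : IsDistribMeetSemilattice M) :
    DirectedOn (· ≤ ·) (pointFilter (core M) P)ᶜ ↔ DirectedOn (· ≤ ·) P.1ᶜ := by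
  have himage : (pointFilter (core M) P)ᶜ = basic hM '' P.1ᶜ :=
    (Set.image_preimage_eq _ basic_surjective).symm
  have hle : (basic hM ⁻¹'o (· ≤ ·)) = (· ≤ ·) := by
    ext a b
    exact basic_le_basic_iff
  rw [himage, directedOn_image, hle]

end Core

end OptimalFilter

open OptimalFilter in
/-- The generalized Priestley space of a bounded distributive meet-semilattice. -/
noncomputable def BDMSP.spectrum (M : BDMSP.{u}) : GPSP.{u} where
  carrier := OptimalFilter M
  core := core M
  dense_core := dense_core M.distrib
  exists_le_core P := by
    obtain ⟨Q, hQ, hPQ, -⟩ := exists_mem_core_le M.distrib P.2.bot_notMem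
    exact ⟨Q, hQ, hPQ⟩
  mem_core_iff P := by
    rw [← directedOn_compl_pointFilter_iff, directedOn_compl_pointFilter_core_iff M.distrib,
      mem_core_iff_directedOn_compl]
  le_iff P Q := ⟨fun h U hU hP => hU.isUpperSet h hP,
    fun h a ha => h _ (isAdmissible_setOf_mem M.distrib a) ha⟩

namespace GPSP

instance : admissibleFunctor.{u}.EssSurj where
  mem_essImage M := ⟨Opposite.op M.spectrum,
    ⟨BDMSP.isoOfOrderIso (M := M.spectrum.admissibleUpsets)
      (OptimalFilter.basicIso M.distrib).symm⟩⟩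

instance : admissibleFunctor.{u}.IsEquivalence where

end GPSP

theorem mainTheorem7 :
    Nonempty (KAlgFrm.{u} ≌ BDMSP.{u}) ∧
    Nonempty (KAlgFrm.{u}ᵒᵖ ≌ GPSP.{u}) ∧
    (∀ (M N : BDMSP.{u}) (α : InfTopHom M N),
      LiftsUpperBounds α ↔ ∀ P : Set N, IsPrimeFilter P → IsPrimeFilter (α ⁻¹' P)) ∧
    Nonempty (BDJS.{u}ᵒᵖ ≌ GPSP.{u}) := by
  have e : BDMSP.{u}ᵒᵖ ≌ GPSP.{u} :=
    GPSP.admissibleFunctor.asEquivalence.symm.op.trans (opOpEquivalence GPSP)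
  exact ⟨⟨KAlgFrm.compactsFunctor.asEquivalence⟩,
    ⟨KAlgFrm.compactsFunctor.asEquivalence.op.trans e⟩,
    fun _ N α => liftsUpperBounds_iff_isPrimeFilter_preimage N.distrib α,
    ⟨BDJS.dualFunctor.asEquivalence.op.trans e⟩⟩
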